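/- Let $(R,\mathfrak m,k)$ be a commutative Noetherian local ring, and let $M$ and $N\neq 0$ be finitely generated $R$-modules. Write $\mu_R(N)$ for the minimal number of generators of $N$, write $\beta_i^R(M)$ for the $i$-th Betti number of $M$ (the rank of the $i$-th free module in the minimal free resolution of $M$), and let $$e_R(N)=n!\,\lim_{j\to\infty}\frac{\ell_R(N/\mathfrak m^{j}N)}{j^{n}},\qquad n=\dim_R N,$$ be the Hilbert–Samuel multiplicity of $N$ (this limit exists). Assume that $N$ is Cohen–Macaulay, and that for some integer $t\ge 1$ one has $\operatorname{Ext}^i_R(M,N)=0$ for all $t\le i\le t+n$. Then $$\beta_{t+1}^R(M)\;\ge\;\frac{\mu_R(N)}{e_R(N)-\mu_R(N)}\cdot\beta_t^R(M)$$ if $e_R(N)\neq\mu_R(N)$, and $\beta_t^R(M)=0$ if $e_R(N)=\mu_R(N)$. -/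

import Mathlib

universe u

namespace LocalAlg

section Basic

variable (R : Type u) [CommRing R] (M : Type u) [AddCommGroup M] [Module R M]

/-- The minimal number of generators `μ_R(M)` of a finitely generated module. -/
noncomputable def numGen : ℕ := (⊤ : Submodule R M).spanFinrank

/-- A chosen generating family of `M` with `μ_R(M)` members (for `M` finitely generated). -/
noncomputable def minGens : Fin (numGen R M) → M :=
  Classical.epsilon fun g : Fin (numGen R M) → M => Submodule.span R (Set.range g) = ⊤

/-- The minimal free cover `R ^ μ_R(M) → M` attached to the chosen minimal generators. -/
noncomputable def minCover : (Fin (numGen R M) → R) →ₗ[R] M :=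
  Fintype.linearCombination R (minGens R M)

/-- The first syzygy `Ω_R(M)`: the kernel of the minimal free cover of `M`. -/
noncomputable def firstSyzygy : Submodule R (Fin (numGen R M) → R) :=
  LinearMap.ker (minCover R M)

theorem span_minGens [Module.Finite R M] :
    Submodule.span R (Set.range (minGens R M)) = ⊤ := by
  refine Classical.epsilon_spec
    (p := fun g : Fin (numGen R M) → M => Submodule.span R (Set.range g) = ⊤) ?_
  have hfg : (⊤ : Submodule R M).FG := Module.Finite.fg_top
  have : Finite (⊤ : Submodule R M).generators := hfg.finite_generators
  let e : (⊤ : Submodule R M).generators ≃ Fin (numGen R M) :=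
    Finite.equivFinOfCardEq (by
      rw [Nat.card_coe_set_eq]
      exact hfg.generators_ncard)
  refine ⟨fun i => ((e.symm i : (⊤ : Submodule R M).generators) : M), ?_⟩
  have hr : Set.range (fun i => ((e.symm i : (⊤ : Submodule R M).generators) : M)) =
      (⊤ : Submodule R M).generators := by
    ext x
    constructor
    · rintro ⟨i, rfl⟩
      exact (e.symm i).2
    · intro hx
      exact ⟨e ⟨x, hx⟩, by simp⟩
  rw [hr, Submodule.span_generators]

theorem minCover_surjective [Module.Finite R M] : Function.Surjective (minCover R M) := by
  rw [← LinearMap.range_eq_top, minCover, Fintype.range_linearCombination, span_minGens]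

end Basic

/-- The `i`-th Betti number `β_i^R(M)` of a finitely generated module over a Noetherian local
ring: the rank of the `i`-th free module in the minimal free resolution of `M`. That resolution is
obtained by covering `M` minimally by a free module, then covering its first syzygy minimally,
and so on, so that `β_0(M) = μ(M)` and `β_{i+1}(M) = β_i(Ω M)`. -/
noncomputable def betti (R : Type u) [CommRing R] :
    ℕ → (M : Type u) → [AddCommGroup M] → [Module R M] → ℕ
  | 0, M, _, _ => numGen R M
  | i + 1, M, _, _ => betti R i (firstSyzygy R M)

section Multiplicity

variable (R : Type u) [CommRing R] (M : Type u) [AddCommGroup M] [Module R M]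

/-- The Krull dimension of `M` as a natural number (for finitely generated modules over Noetherian
local rings the dimension is finite; the zero module gets the value `0`). -/
noncomputable def natDim : ℕ := ((Module.supportDim R M).unbotD 0).toNat

/-- The sequence `k ↦ d! · ℓ_R(M / I ^ k M) / k ^ d`, where `d = dim M`. -/
noncomputable def hilbertSamuelSeq (I : Ideal R) (k : ℕ) : ℝ :=
  ((natDim R M).factorial : ℝ) *
    ((Module.length R (M ⧸ (I ^ k • (⊤ : Submodule R M)))).toNat : ℝ) / (k : ℝ) ^ natDim R M

/-- The Hilbert–Samuel multiplicity `e_R(I, M) = d! · lim ℓ_R(M / I ^ k M) / k ^ d`, `d = dim M`.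
It is `0` for the zero module. -/
noncomputable def multiplicity (I : Ideal R) : ℝ :=
  Filter.limUnder Filter.atTop (hilbertSamuelSeq R M I)

end Multiplicity

section CohenMacaulay

variable (R : Type u) [CommRing R] [IsLocalRing R] (M : Type u) [AddCommGroup M] [Module R M]

/-- The depth of a nonzero module over a local ring: the supremum of the lengths of `M`-regular
sequences in the maximal ideal. -/
noncomputable def depth : ℕ∞ :=
  ⨆ (rs : List R) (_ : ∀ r ∈ rs, r ∈ IsLocalRing.maximalIdeal R)
    (_ : RingTheory.Sequence.IsRegular M rs), (rs.length : ℕ∞)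

/-- A (finitely generated) module over a (Noetherian) local ring is Cohen–Macaulay if it is zero
or its depth equals its Krull dimension. -/
def IsCohenMacaulay : Prop :=
  Subsingleton M ∨ (depth R M : WithBot ℕ∞) = Module.supportDim R M

end CohenMacaulay

end LocalAlg

/-! ### Vanishing of Ext as extension of maps from syzygies -/

namespace LocalAlg

open IsLocalRing CategoryTheory TensorProduct

/-! Replacing `M` by its syzygy `Y = Ω^(t-1) M` moves the Ext vanishing to degrees `1, …, n + 1` and
turns `β_t`, `β_(t+1)` into `β_1(Y)`, `β_2(Y)`.

Suppose first that `L` has finite length and `Ext¹(Y, L) = 0`. For the minimal resolution `F₂ → F₁ →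
F₀` of `Y`, a tuple in the kernel of `Hom(F₁, L) → Hom(F₂, L)` is a map `ΩY → L`; it extends to
`F₀`, and `ΩY ⊆ m F₀`, so its entries lie in `mL`. By minimality the image also has entries in `mL`.
Counting lengths gives `β₁ ℓ(L) ≤ (β₁ + β₂) ℓ(mL)`, that is `β₁ ℓ(L/mL) ≤ β₂ ℓ(mL)`
(`betti_mul_length_le`).

It remains to find such an `L` with `ℓ(L) = e(N)` and `ℓ(L/mL) = μ(N)`. The flat extension `R → S =
R(X)` makes the residue field infinite and preserves the Hilbert function. Over `S`, the
Cohen–Macaulay module `S ⊗ N` is divided by `n` successive regular superficial elements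
(`exists_superficial`, `exists_finite_length_reduction`). Each division keeps `e` and `μ` and uses
up one degree of Ext vanishing, so degree `1` survives. Only the coefficient module is extended: `Y`
and its resolution stay over `R`. -/

/-- Every linear map from the first syzygy of `X` to `N` extends to the minimal free cover of `X`;
this amounts to `Ext¹(X, N) = 0`. -/
def SyzygyMapsExtend (R : Type u) [CommRing R] (X : Type u) [AddCommGroup X] [Module R X]
    (N : Type u) [AddCommGroup N] [Module R N] : Prop :=
  ∀ f : firstSyzygy R X →ₗ[R] N, ∃ g : (Fin (numGen R X) → R) →ₗ[R] N,
    ∀ y : firstSyzygy R X, g y = f y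

/-- `SyzygyMapsExtend` holds for the first `k` modules among `X, Ω X, Ω² X, …`. -/
def SyzygyMapsExtendUpTo (R : Type u) [CommRing R] (N : Type u) [AddCommGroup N] [Module R N] :
    ℕ → (X : Type u) → [AddCommGroup X] → [Module R X] → Prop
  | 0, _, _, _ => True
  | k + 1, X, _, _ => SyzygyMapsExtend R X N ∧ SyzygyMapsExtendUpTo R N k (firstSyzygy R X)

section Ext

variable (R : Type u) [CommRing R] (X : Type u) [AddCommGroup X] [Module R X]

/-- The short complex `Ω X → R ^ μ(X) → X`. -/
noncomputable def syzygyShortComplex : ShortComplex (ModuleCat.{u} R) :=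
  ShortComplex.mk (ModuleCat.ofHom (firstSyzygy R X).subtype) (ModuleCat.ofHom (minCover R X))
    (by ext x; exact congrFun rfl x |>.trans x.2)

theorem syzygyShortComplex_shortExact [Module.Finite R X] :
    (syzygyShortComplex R X).ShortExact where
  exact := by
    rw [ShortComplex.ShortExact.moduleCat_exact_iff_function_exact]
    exact LinearMap.exact_subtype_ker_map _
  mono_f := (ModuleCat.mono_iff_injective _).2 (firstSyzygy R X).injective_subtype
  epi_g := (ModuleCat.epi_iff_surjective _).2 (minCover_surjective R X)

variable {R X} {N : Type u} [AddCommGroup N] [Module R N]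

/-- The obstruction to extending `f` is its image in `Ext¹(X, N)` under the connecting map. -/
theorem syzygyMapsExtend_of_subsingleton_ext [Module.Finite R X]
    (h : Subsingleton (Abelian.Ext (ModuleCat.of R X) (ModuleCat.of R N) 1)) :
    SyzygyMapsExtend R X N := by
  intro f
  obtain ⟨x₂, hx₂⟩ := Abelian.Ext.contravariant_sequence_exact₁
    (syzygyShortComplex_shortExact R X) (ModuleCat.of R N)
    (Abelian.Ext.mk₀ (ModuleCat.ofHom f)) (n₁ := 1) rfl (h.elim _ _)
  obtain ⟨g, rfl⟩ := Abelian.Ext.addEquiv₀.symm.surjective x₂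
  refine ⟨g.hom, fun y => ?_⟩
  have hx : (syzygyShortComplex R X).f ≫ g = ModuleCat.ofHom f :=
    (Abelian.Ext.mk₀_bijective _ _).1 (by simpa [Abelian.Ext.addEquiv₀] using hx₂)
  exact congrArg (fun φ => φ.hom y) hx

theorem subsingleton_ext_firstSyzygy [Module.Finite R X] {i : ℕ} (hi : 1 ≤ i)
    (h : Subsingleton (Abelian.Ext (ModuleCat.of R X) (ModuleCat.of R N) (i + 1))) :
    Subsingleton (Abelian.Ext (ModuleCat.of R (firstSyzygy R X)) (ModuleCat.of R N) i) := by
  refine subsingleton_of_forall_eq 0 fun x => ?_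
  obtain ⟨x₂, hx₂⟩ := Abelian.Ext.contravariant_sequence_exact₁
    (syzygyShortComplex_shortExact R X) (ModuleCat.of R N) x (n₁ := i + 1) (add_comm _ _)
    (h.elim _ _)
  -- Ext out of the free cover vanishes only in positive degrees, hence the bound `1 ≤ i`.
  obtain ⟨j, rfl⟩ : ∃ j, i = j + 1 := ⟨i - 1, by omega⟩
  have : Projective (syzygyShortComplex R X).X₂ :=
    (IsProjective.iff_projective (R := R) (Fin (numGen R X) → R)).1 inferInstance
  rw [← hx₂, Abelian.Ext.eq_zero_of_projective x₂, Abelian.Ext.comp_zero]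
  rfl

theorem syzygyMapsExtendUpTo_of_subsingleton_ext [IsNoetherianRing R] (k : ℕ) :
    ∀ (X : Type u) [AddCommGroup X] [Module R X] [Module.Finite R X],
    (∀ i, 1 ≤ i → i ≤ k →
      Subsingleton (Abelian.Ext (ModuleCat.of R X) (ModuleCat.of R N) i)) →
    SyzygyMapsExtendUpTo R N k X := by
  induction k with
  | zero => intros; trivial
  | succ k ih =>
    intro X _ _ _ h
    exact ⟨syzygyMapsExtend_of_subsingleton_ext (h 1 le_rfl (by omega)),
      ih _ fun i h1 hi => subsingleton_ext_firstSyzygy h1 (h (i + 1) (by omega) (by omega))⟩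

/-- Passing to a syzygy module, vanishing of `Ext` in the degrees `t, …, t + n` becomes vanishing
in the degrees `1, …, n + 1`. -/
theorem exists_syzygyMapsExtendUpTo [IsNoetherianRing R] (n t : ℕ) :
    ∀ (X : Type u) [AddCommGroup X] [Module R X] [Module.Finite R X],
    (∀ i, t + 1 ≤ i → i ≤ t + 1 + n →
      Subsingleton (Abelian.Ext (ModuleCat.of R X) (ModuleCat.of R N) i)) →
    ∃ (Y : Type u) (_ : AddCommGroup Y) (_ : Module R Y), Module.Finite R Y ∧
      betti R (t + 1) X = betti R 1 Y ∧ betti R (t + 2) X = betti R 2 Y ∧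
      SyzygyMapsExtendUpTo R N (n + 1) Y := by
  induction t with
  | zero =>
    intro X _ _ _ h
    exact ⟨X, _, _, ‹_›, rfl, rfl, syzygyMapsExtendUpTo_of_subsingleton_ext _ _
      fun i h1 hi => h i (by omega) (by omega)⟩
  | succ t ih =>
    intro X _ _ _ h
    exact ih (firstSyzygy R X) fun i h1 hi =>
      subsingleton_ext_firstSyzygy (by omega) (h (i + 1) (by omega) (by omega))

end Ext

/-! ### Passing the extension property to quotients and flat base changes -/

section Transfer

variable {R : Type u} [CommRing R] {N : Type u} [AddCommGroup N] [Module R N]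
  {X : Type u} [AddCommGroup X] [Module R X]

/-- A linear map on the free cover of `X` that kills the first syzygy descends to `X`. -/
theorem exists_comp_minCover_eq [Module.Finite R X] {P : Type*} [AddCommGroup P] [Module R P]
    (h : (Fin (numGen R X) → R) →ₗ[R] P) (hh : ∀ y ∈ firstSyzygy R X, h y = 0) :
    ∃ f : X →ₗ[R] P, ∀ v, f (minCover R X v) = h v := by
  let e := (minCover R X).quotKerEquivOfSurjective (minCover_surjective R X)
  refine ⟨(Submodule.liftQ (firstSyzygy R X) h fun y hy => LinearMap.mem_ker.2 (hh y hy)).comp e.symm.toLinearMap, fun v => ?_⟩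
  have : e.symm (minCover R X v) = Submodule.Quotient.mk v := by
    rw [LinearEquiv.symm_apply_eq]; rfl
  exact congrArg (Submodule.liftQ (firstSyzygy R X) h fun y hy => LinearMap.mem_ker.2 (hh y hy)) this

/-- This is exactness of `Ext¹(X, N) → Ext¹(X, P) → Ext²(X, N) = Ext¹(ΩX, N)`, done by hand. The map
`i` will be multiplication by an element of an `R`-algebra, so it is kept as an arbitrary injective
endomorphism. -/
theorem SyzygyMapsExtend.of_surjective [IsNoetherianRing R] [Module.Finite R X]
    {P : Type u} [AddCommGroup P] [Module R P] (i : N →ₗ[R] N) (q : N →ₗ[R] P)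
    (hi : Function.Injective i) (hiq : Function.Exact i q) (hq : Function.Surjective q)
    (h0 : SyzygyMapsExtend R X N) (h1 : SyzygyMapsExtend R (firstSyzygy R X) N) :
    SyzygyMapsExtend R X P := by
  intro f
  let Y := firstSyzygy R X
  obtain ⟨h, hh⟩ := Module.projective_lifting_property q (f ∘ₗ minCover R Y) hq
  have hker : ∀ y : firstSyzygy R Y, h y ∈ LinearMap.range i := fun y => by
    have hy : minCover R Y y = 0 := y.2
    obtain ⟨z, hz⟩ := (hiq (h y)).1 (by
      simpa [hy] using LinearMap.congr_fun hh (y : Fin (numGen R Y) → R))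
    exact ⟨z, hz⟩
  let j := LinearEquiv.ofInjective i hi
  obtain ⟨h', hh'⟩ := h1 (j.symm.toLinearMap ∘ₗ
    (h ∘ₗ (firstSyzygy R Y).subtype).codRestrict (LinearMap.range i) hker)
  -- The lift `h` fails to descend to `ΩX` only by its values on `Ω²X`, which lie in `i(N)`;
  -- subtracting `i ∘ h'` removes them without changing the composite with `q`.
  obtain ⟨f', hf'⟩ := exists_comp_minCover_eq (X := Y) (h - i ∘ₗ h') (fun y hy => by
    have := hh' ⟨y, hy⟩
    simp only [LinearMap.sub_apply, LinearMap.comp_apply, sub_eq_zero]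
    rw [this]
    have := congrArg Subtype.val (j.apply_symm_apply ⟨h y, hker ⟨y, hy⟩⟩)
    exact this.symm)
  obtain ⟨g, hg⟩ := h0 f'
  refine ⟨q ∘ₗ g, fun y => ?_⟩
  obtain ⟨v, rfl⟩ := minCover_surjective R Y y
  simp only [LinearMap.comp_apply, hg, hf', LinearMap.sub_apply, map_sub]
  rw [(hiq _).2 ⟨_, rfl⟩, sub_zero]
  exact LinearMap.congr_fun hh v

theorem SyzygyMapsExtendUpTo.of_surjective [IsNoetherianRing R]
    {P : Type u} [AddCommGroup P] [Module R P] (i : N →ₗ[R] N) (q : N →ₗ[R] P)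
    (hi : Function.Injective i) (hiq : Function.Exact i q) (hq : Function.Surjective q) (k : ℕ) :
    ∀ (X : Type u) [AddCommGroup X] [Module R X] [Module.Finite R X],
    SyzygyMapsExtendUpTo R N (k + 1) X → SyzygyMapsExtendUpTo R P k X := by
  induction k with
  | zero => intros; trivial
  | succ k ih =>
    intro X _ _ _ h
    exact ⟨SyzygyMapsExtend.of_surjective i q hi hiq hq h.1 h.2.1,
      ih _ h.2⟩

/-- As `ΩX` is finitely presented and `S` is flat, `Hom_S(S ⊗ ΩX, S ⊗ N)` is spanned over `S` by
base changes of maps `ΩX → N`, and these extend. -/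
theorem SyzygyMapsExtend.baseChange [IsNoetherianRing R] [Module.Finite R X]
    (S : Type u) [CommRing S] [Algebra R S] [Module.Flat R S]
    (h : SyzygyMapsExtend R X N) : SyzygyMapsExtend R X (S ⊗[R] N) := by
  have key : ∀ F : S ⊗[R] firstSyzygy R X →ₗ[S] S ⊗[R] N,
      ∃ g : (Fin (numGen R X) → R) →ₗ[R] S ⊗[R] N,
        ∀ y : firstSyzygy R X, g y = F (1 ⊗ₜ y) := by
    intro F
    have : Module.FinitePresentation R (firstSyzygy R X) :=
      Module.finitePresentation_of_finite R _
    refine (Module.FinitePresentation.isBaseChange_map R (firstSyzygy R X) N S).inductionOn F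
      _ ?_ ?_ ?_ ?_
    · exact ⟨0, by simp⟩
    · intro φ
      obtain ⟨g, hg⟩ := h φ
      exact ⟨(TensorProduct.mk R S N 1) ∘ₗ g, fun y => by simp [hg]⟩
    · rintro s F ⟨g, hg⟩
      exact ⟨s • g, fun y => by simp [hg]⟩
    · rintro F₁ F₂ ⟨g₁, h₁⟩ ⟨g₂, h₂⟩
      exact ⟨g₁ + g₂, fun y => by simp [h₁, h₂]⟩
  intro f
  obtain ⟨g, hg⟩ := key (f.liftBaseChange S)
  exact ⟨g, fun y => by simp [hg]⟩

theorem SyzygyMapsExtendUpTo.baseChange [IsNoetherianRing R]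
    (S : Type u) [CommRing S] [Algebra R S] [Module.Flat R S] (k : ℕ) :
    ∀ (X : Type u) [AddCommGroup X] [Module R X] [Module.Finite R X],
    SyzygyMapsExtendUpTo R N k X → SyzygyMapsExtendUpTo R (S ⊗[R] N) k X := by
  induction k with
  | zero => intros; trivial
  | succ k ih => intro X _ _ _ h; exact ⟨h.1.baseChange S, ih _ h.2⟩

end Transfer

end LocalAlg

namespace LocalAlg

open IsLocalRing CategoryTheory TensorProduct

/-! ### Minimality of the free cover and the length count -/

section Minimality

variable {R : Type u} [CommRing R] [IsLocalRing R] {X : Type u} [AddCommGroup X] [Module R X]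

/-- The free cover on a minimal set of generators is minimal: relations have coefficients in the
maximal ideal. -/
theorem apply_mem_maximalIdeal_of_mem_firstSyzygy [Module.Finite R X]
    {y : Fin (numGen R X) → R} (hy : y ∈ firstSyzygy R X) (i : Fin (numGen R X)) :
    y i ∈ maximalIdeal R := by
  classical
  by_contra hi
  have hu : IsUnit (y i) := by simpa using hi
  have hsum : ∑ j, y j • minGens R X j = 0 := by
    have : minCover R X y = 0 := hy
    rwa [minCover, Fintype.linearCombination_apply] at this
  let T : Finset X := (Finset.univ.erase i).image (minGens R X)
  have hi' : minGens R X i ∈ Submodule.span R (T : Set X) := by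
    rw [← Finset.add_sum_erase _ _ (Finset.mem_univ i), add_eq_zero_iff_eq_neg] at hsum
    rw [← Submodule.smul_mem_iff_of_isUnit _ hu, hsum]
    refine Submodule.neg_mem _ (Submodule.sum_mem _ fun j hj => Submodule.smul_mem _ _ ?_)
    exact Submodule.subset_span (Finset.mem_coe.2 (Finset.mem_image_of_mem _ hj))
  have hT : Submodule.span R (T : Set X) = ⊤ := by
    rw [eq_top_iff, ← span_minGens R X, Submodule.span_le]
    rintro _ ⟨j, rfl⟩
    by_cases hj : j = i
    · exact hj ▸ hi'
    · exact Submodule.subset_span (Finset.mem_coe.2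
        (Finset.mem_image_of_mem _ (Finset.mem_erase.2 ⟨hj, Finset.mem_univ j⟩)))
  have h1 : numGen R X ≤ T.card := by
    have := Submodule.spanFinrank_span_le_ncard_of_finite (R := R) T.finite_toSet
    rwa [hT, Set.ncard_coe_finset] at this
  have h2 : T.card ≤ numGen R X - 1 :=
    Finset.card_image_le.trans (by simp [Finset.card_erase_of_mem])
  have := i.pos
  omega

end Minimality

section Count

open Module

theorem length_le_card_mul_length {S L : Type*} [CommRing S] [AddCommGroup L] [Module S L]
    {b : ℕ} (P : Submodule S (Fin b → L)) (Q : Submodule S L) (h : ∀ v ∈ P, ∀ i, v i ∈ Q) :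
    length S P ≤ b * length S Q := by
  let f : P →ₗ[S] Fin b → Q :=
    LinearMap.pi fun i => ((LinearMap.proj i).comp P.subtype).codRestrict Q fun v => h v v.2 i
  have hf : Function.Injective f := fun v w hvw => by
    ext i
    exact congrArg Subtype.val (congrFun hvw i)
  simpa [length_pi] using length_le_of_injective f hf

/-- The syzygy count: if every map from `Ω X` to `L` extends to the free cover of `X`, the kernel
and the image of `Hom(F₁, L) → Hom(F₂, L)` consist of tuples from `I L`. -/
theorem betti_mul_length_le {R : Type u} [CommRing R] [IsNoetherianRing R] [IsLocalRing R]
    {X : Type u} [AddCommGroup X] [Module R X] [Module.Finite R X]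
    {S : Type u} [CommRing S] [Algebra R S] (I : Ideal S)
    (hI : (maximalIdeal R).map (algebraMap R S) ≤ I)
    {L : Type u} [AddCommGroup L] [Module R L] [Module S L] [IsScalarTower R S L]
    (h : SyzygyMapsExtend R X L) :
    (betti R 1 X : ℕ∞) * length S L ≤
      (betti R 1 X + betti R 2 X : ℕ∞) * length S (I • ⊤ : Submodule S L) := by
  let Y := firstSyzygy R X
  let A : Fin (numGen R (firstSyzygy R Y)) → firstSyzygy R Y := minGens R (firstSyzygy R Y)
  have hsmul : ∀ r ∈ maximalIdeal R, ∀ l : L, r • l ∈ (I • ⊤ : Submodule S L) := fun r hr l => by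
    rw [← algebraMap_smul S r l]
    exact Submodule.smul_mem_smul (hI (Ideal.mem_map_of_mem _ hr)) trivial
  -- This is `Hom(F₂ → F₁, L)`: the rows of the matrix are minimal generators of `Ω²X`.
  let φ : (Fin (numGen R Y) → L) →ₗ[S] Fin (numGen R (firstSyzygy R Y)) → L :=
    LinearMap.pi fun j => ∑ i, algebraMap R S ((A j : Fin (numGen R Y) → R) i) • LinearMap.proj i
  have hφ : ∀ v j, φ v j = ∑ i, (A j : Fin (numGen R Y) → R) i • v i := fun v j => by
    simp [φ]
  have hker : ∀ v ∈ LinearMap.ker φ, ∀ i, v i ∈ (I • ⊤ : Submodule S L) := by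
    intro v hv i
    have hrel : firstSyzygy R Y ≤ LinearMap.ker (Fintype.linearCombination R v) := by
      have : Submodule.map (firstSyzygy R Y).subtype (Submodule.span R (Set.range A)) ≤
          LinearMap.ker (Fintype.linearCombination R v) := by
        rw [Submodule.map_span, Submodule.span_le]
        rintro _ ⟨_, ⟨j, rfl⟩, rfl⟩
        have := congrFun hv j
        rw [hφ] at this
        simpa [Fintype.linearCombination_apply] using this
      rwa [span_minGens, Submodule.map_subtype_top] at this
    obtain ⟨f, hf⟩ := exists_comp_minCover_eq (X := Y) (Fintype.linearCombination R v) hrel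
    obtain ⟨g, hg⟩ := h f
    -- `v` lists the values of `f` on the generators of `ΩX`. These are values of `g` on vectors
    -- with entries in the maximal ideal.
    have hv' : v i = g (minGens R Y i : Fin (numGen R X) → R) := by
      have h1 := hf (Pi.single i 1)
      rw [hg, minCover] at *
      simpa using h1.symm
    rw [hv', pi_eq_sum_univ (minGens R Y i : Fin (numGen R X) → R), map_sum]
    refine Submodule.sum_mem _ fun k _ => ?_
    rw [map_smul]
    exact hsmul _ (apply_mem_maximalIdeal_of_mem_firstSyzygy (minGens R Y i).2 k) _
  have hrange : ∀ v ∈ LinearMap.range φ, ∀ j, v j ∈ (I • ⊤ : Submodule S L) := by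
    rintro _ ⟨v, rfl⟩ j
    rw [hφ]
    exact Submodule.sum_mem _ fun i _ =>
      hsmul _ (apply_mem_maximalIdeal_of_mem_firstSyzygy (A j).2 i) _
  calc (betti R 1 X : ℕ∞) * length S L = length S (Fin (numGen R Y) → L) := by
        rw [length_pi]; simp; rfl
    _ = length S (LinearMap.ker φ) + length S (LinearMap.range φ) :=
        length_eq_add_of_exact (LinearMap.ker φ).subtype φ.rangeRestrict
          (LinearMap.ker φ).injective_subtype φ.surjective_rangeRestrict
          (by rw [LinearMap.exact_iff, LinearMap.ker_rangeRestrict, Submodule.range_subtype])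
    _ ≤ _ := by
        rw [add_mul]
        exact add_le_add (length_le_card_mul_length _ _ hker)
          (length_le_card_mul_length _ _ hrange)

end Count

end LocalAlg

namespace LocalAlg

open IsLocalRing CategoryTheory TensorProduct

/-! ### Flat extension to an infinite residue field, and the Hilbert function -/

section Nagata

open Polynomial

/-- The ring `R(X)`: the localization of `R[X]` at the extension of the maximal ideal of `R`. -/
abbrev NagataRing (R : Type u) [CommRing R] [IsLocalRing R] : Type u :=
  Localization.AtPrime ((maximalIdeal R).map (C : R →+* R[X]))

variable (R : Type u) [CommRing R] [IsLocalRing R]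

theorem map_maximalIdeal_nagataRing :
    (maximalIdeal R).map (algebraMap R (NagataRing R)) = maximalIdeal (NagataRing R) := by
  rw [IsScalarTower.algebraMap_eq R R[X] (NagataRing R), ← Ideal.map_map]
  exact Localization.AtPrime.map_eq_maximalIdeal

instance : IsLocalHom (algebraMap R (NagataRing R)) :=
  ((local_hom_TFAE (algebraMap R (NagataRing R))).out 0 2).2 (map_maximalIdeal_nagataRing R).le

instance : Module.Flat R (NagataRing R) :=
  have : Module.Flat R[X] (NagataRing R) :=
    IsLocalization.flat _ ((maximalIdeal R).map (C : R →+* R[X])).primeCompl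
  Module.Flat.trans R R[X] (NagataRing R)

instance : Infinite (ResidueField (NagataRing R)) := by
  -- The powers of `X` have distinct residues: for `i ≠ j`, `X ^ i - X ^ j` has a coefficient `1`,
  -- so it lies outside `m R[X]`.
  refine Infinite.of_injective
    (fun i : ℕ => residue (NagataRing R) (algebraMap R[X] (NagataRing R) (X ^ i))) ?_
  intro i j hij
  by_contra hne
  have h1 : residue (NagataRing R) (algebraMap R[X] (NagataRing R) (X ^ i - X ^ j)) = 0 := by
    rw [map_sub, map_sub, sub_eq_zero]
    exact hij
  rw [residue_eq_zero_iff, mem_maximalIdeal, mem_nonunits_iff,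
    IsLocalization.AtPrime.isUnit_to_map_iff _ ((maximalIdeal R).map (C : R →+* R[X]))] at h1
  have h2 := Ideal.mem_map_C_iff.1 (not_not.1 h1) i
  rw [coeff_sub, coeff_X_pow_self, coeff_X_pow, if_neg hne, sub_zero] at h2
  exact (Ideal.ne_top_iff_one _).1 (maximalIdeal.isMaximal R).ne_top h2

end Nagata

section QuotientBaseChange

variable {R : Type*} [CommRing R] (S : Type*) [CommRing S] [Algebra R S]
  (N : Type*) [AddCommGroup N] [Module R N] (I : Ideal R)

theorem ker_baseChange_mkQ :
    LinearMap.ker ((I • ⊤ : Submodule R N).mkQ.baseChange S) =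
      (I.map (algebraMap R S) • ⊤ : Submodule S (S ⊗[R] N)) := by
  apply le_antisymm
  · intro z hz
    obtain ⟨w, rfl⟩ := (lTensor_exact S (LinearMap.exact_subtype_mkQ (I • ⊤ : Submodule R N))
      (Submodule.mkQ_surjective _) z).1 hz
    clear hz
    induction w with
    | zero => simp
    | add a b ha hb =>
      rw [map_add]
      exact Submodule.add_mem _ ha hb
    | tmul s y =>
      obtain ⟨y, hy⟩ := y
      simp only [LinearMap.lTensor_tmul, Submodule.subtype_apply]
      induction hy using Submodule.smul_induction_on' with
      | smul r hr n hn =>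
        rw [TensorProduct.tmul_smul, ← algebraMap_smul S r]
        exact Submodule.smul_mem_smul (Ideal.mem_map_of_mem _ hr) trivial
      | add x hx y hy h1 h2 =>
        rw [TensorProduct.tmul_add]
        exact Submodule.add_mem _ h1 h2
  · rw [Submodule.smul_le]
    intro r hr z _
    rw [LinearMap.mem_ker, map_smul]
    generalize (LinearMap.baseChange S (I • ⊤ : Submodule R N).mkQ) z = q
    induction hr using Submodule.span_induction with
    | mem r hr =>
      obtain ⟨a, ha, rfl⟩ := hr
      rw [algebraMap_smul]
      induction q with
      | zero => simp
      | add x y hx hy => rw [smul_add, hx, hy, add_zero]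
      | tmul s n =>
        obtain ⟨n, rfl⟩ := Submodule.mkQ_surjective _ n
        rw [← TensorProduct.tmul_smul, ← map_smul]
        have : (I • ⊤ : Submodule R N).mkQ (a • n) = 0 :=
          (Submodule.Quotient.mk_eq_zero _).2 (Submodule.smul_mem_smul ha trivial)
        rw [this, TensorProduct.tmul_zero]
    | zero => simp
    | add x y _ _ hx hy => rw [add_smul, hx, hy, add_zero]
    | smul c x _ hx => rw [smul_assoc, hx, smul_zero]

/-- Base change commutes with `N ↦ N / I N`. -/
noncomputable def quotSMulTopBaseChangeEquiv :
    ((S ⊗[R] N) ⧸ (I.map (algebraMap R S) • ⊤ : Submodule S (S ⊗[R] N))) ≃ₗ[S]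
      S ⊗[R] (N ⧸ (I • ⊤ : Submodule R N)) :=
  (Submodule.quotEquivOfEq _ _ (ker_baseChange_mkQ S N I).symm).trans
    (LinearMap.quotKerEquivOfSurjective _
      (LinearMap.lTensor_surjective S (Submodule.mkQ_surjective _)))

end QuotientBaseChange

section HilbertFunction

variable (R : Type*) [CommRing R] [IsLocalRing R] (N : Type*) [AddCommGroup N] [Module R N]

/-- The Hilbert–Samuel function `j ↦ ℓ(N / m ^ j N)`. -/
noncomputable def hilbertFun (j : ℕ) : ℕ∞ :=
  Module.length R (N ⧸ (maximalIdeal R ^ j • ⊤ : Submodule R N))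

/-- Flat local base change multiplies length by the length of the closed fibre `S / mS`, here a
field. -/
theorem hilbertFun_baseChange (S : Type*) [CommRing S] [IsLocalRing S] [Algebra R S]
    [Module.Flat R S] (hS : (maximalIdeal R).map (algebraMap R S) = maximalIdeal S) (j : ℕ) :
    hilbertFun S (S ⊗[R] N) j = hilbertFun R N j := by
  have : IsLocalHom (algebraMap R S) :=
    ((local_hom_TFAE (algebraMap R S)).out 0 2).2 hS.le
  have h1 : Module.length S (S ⧸ maximalIdeal S) = 1 :=
    have : IsSimpleModule S (S ⧸ maximalIdeal S) :=
      isSimpleModule_iff_quot_maximal.2 ⟨_, maximalIdeal.isMaximal S, ⟨LinearEquiv.refl _ _⟩⟩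
    Module.length_eq_one _ _
  have := (quotSMulTopBaseChangeEquiv S N (maximalIdeal R ^ j)).length_eq
  rw [Ideal.map_pow, hS, IsLocalRing.length_baseChange, hS, h1, mul_one] at this
  exact this

theorem hilbertFun_one [Module.Finite R N] :
    hilbertFun R N 1 = (⊤ : Submodule R N).spanFinrank := by
  rw [IsLocalRing.spanFinrank_eq_finrank_quotient _ Module.Finite.fg_top, hilbertFun, pow_one]
  let e : ((⊤ : Submodule R N) ⧸ (maximalIdeal R • ⊤ : Submodule R (⊤ : Submodule R N))) ≃ₗ[R]
      N ⧸ (maximalIdeal R • ⊤ : Submodule R N) :=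
    Submodule.Quotient.equiv _ _ Submodule.topEquiv (by
      rw [Submodule.map_smul'', Submodule.map_top, LinearMap.range_eq_top.2]
      exact Submodule.topEquiv.surjective)
  rw [← e.length_eq, Module.length_eq_of_surjective (R := R ⧸ maximalIdeal R)
    Ideal.Quotient.mk_surjective]
  let _ := Ideal.Quotient.field (maximalIdeal R)
  exact Module.length_eq_finrank (R ⧸ maximalIdeal R) _

variable {R N}

/-- Such a module is finite over the Artinian ring `R / m ^ c`. -/
theorem isFiniteLength_of_pow_smul_top_eq_bot [IsNoetherianRing R] [Module.Finite R N] {c : ℕ}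
    (h : (maximalIdeal R ^ c • ⊤ : Submodule R N) = ⊥) : IsFiniteLength R N := by
  rcases subsingleton_or_nontrivial N with hN | hN
  · exact .of_subsingleton
  let I := maximalIdeal R ^ c
  have htors : Module.IsTorsionBySet R N I := fun x r => by
    have : (r : R) • x ∈ (I • ⊤ : Submodule R N) := Submodule.smul_mem_smul r.2 trivial
    rw [h] at this
    exact this
  have hI : I ≠ ⊤ := fun hI => by
    rw [show maximalIdeal R ^ c = ⊤ from hI, Submodule.top_smul] at h
    exact top_ne_bot h
  have : Nontrivial (R ⧸ I) := Ideal.Quotient.nontrivial_iff.2 hI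
  have : IsLocalRing (R ⧸ I) := .of_surjective' (Ideal.Quotient.mk I) Ideal.Quotient.mk_surjective
  have : IsArtinianRing (R ⧸ I) := by
    rw [isArtinianRing_iff_isNilpotent_maximalIdeal]
    refine ⟨c, ?_⟩
    have : maximalIdeal (R ⧸ I) = (maximalIdeal R).map (Ideal.Quotient.mk I) := by
      refine le_antisymm (fun x hx => ?_) (((local_hom_TFAE (Ideal.Quotient.mk I)).out 0 2).1
        (IsLocalHom.of_surjective _ Ideal.Quotient.mk_surjective))
      obtain ⟨x, rfl⟩ := Ideal.Quotient.mk_surjective x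
      refine Ideal.mem_map_of_mem _ fun hu => hx (hu.map _)
    rw [this, ← Ideal.map_pow]
    exact Ideal.map_quotient_self I
  let _ := htors.module
  have : IsScalarTower R (R ⧸ I) N := htors.isScalarTower
  have : Module.Finite (R ⧸ I) N := Module.Finite.of_restrictScalars_finite R _ _
  rw [isFiniteLength_iff_isNoetherian_isArtinian]
  refine ⟨inferInstance, ?_⟩
  exact isArtinian_of_surjective_algebraMap (R := R ⧸ I) Ideal.Quotient.mk_surjective

theorem exists_pow_smul_top_eq_bot_of_supportDim_eq_zero [IsNoetherianRing R] [Module.Finite R N]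
    (h : Module.supportDim R N = 0) : ∃ c, (maximalIdeal R ^ c • ⊤ : Submodule R N) = ⊥ := by
  have h1 := support_of_supportDim_eq_zero R N h
  rw [Module.support_eq_zeroLocus, PrimeSpectrum.zeroLocus_eq_iff] at h1
  have h2 : maximalIdeal R ≤ (Module.annihilator R N).radical := h1 ▸ Ideal.le_radical
  obtain ⟨c, hc⟩ := Ideal.exists_pow_le_of_le_radical_of_fg h2
    (IsNoetherian.noetherian (maximalIdeal R))
  refine ⟨c, le_bot_iff.1 (Submodule.smul_le.2 fun r hr n _ => ?_)⟩
  exact (Submodule.mem_bot R).2 (Module.mem_annihilator.1 (hc hr) n)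

theorem supportDim_eq_zero_of_pow_smul_top_eq_bot [Nontrivial N] {c : ℕ}
    (h : (maximalIdeal R ^ c • ⊤ : Submodule R N) = ⊥) : Module.supportDim R N = 0 := by
  have : Subsingleton (Module.support R N) := by
    have key : ∀ p : Module.support R N, (p : PrimeSpectrum R).asIdeal = maximalIdeal R := fun p => by
      have h1 : maximalIdeal R ^ c ≤ (p : PrimeSpectrum R).asIdeal := fun r hr => by
        refine Module.annihilator_le_of_mem_support p.2 (Module.mem_annihilator.2 fun n => ?_)
        have : r • n ∈ (maximalIdeal R ^ c • ⊤ : Submodule R N) := Submodule.smul_mem_smul hr trivial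
        rwa [h] at this
      exact le_antisymm (le_maximalIdeal (p : PrimeSpectrum R).2.ne_top)
        ((p : PrimeSpectrum R).2.le_of_pow_le h1)
    exact ⟨fun p q => Subtype.ext (PrimeSpectrum.ext ((key p).trans (key q).symm))⟩
  have : Nonempty (Module.support R N) := (Module.nonempty_support_of_nontrivial).to_subtype
  exact Order.krullDim_eq_zero

theorem isFiniteLength_quotient_pow_smul_top [IsNoetherianRing R] [Module.Finite R N] (j : ℕ) :
    IsFiniteLength R (N ⧸ (maximalIdeal R ^ j • ⊤ : Submodule R N)) := by
  refine isFiniteLength_of_pow_smul_top_eq_bot (c := j) ?_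
  rw [← LinearMap.range_eq_top.2 (Submodule.mkQ_surjective (maximalIdeal R ^ j • ⊤)),
    ← Submodule.map_top, ← Submodule.map_smul'', Submodule.mkQ_map_self]

end HilbertFunction

end LocalAlg

namespace LocalAlg

open IsLocalRing Filter Topology Asymptotics

/-! ### Growth of the Hilbert function under division by one element -/

section Asymptotic

theorem tendsto_succ_pow_sub_pow_div (d : ℕ) :
    Tendsto (fun j : ℕ => (((j : ℝ) + 1) ^ (d + 1) - (j : ℝ) ^ (d + 1)) / ((j : ℝ) + 1) ^ d)
      atTop (𝓝 (d + 1)) := by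
  have h0 : Tendsto (fun j : ℕ => (j : ℝ) / ((j : ℝ) + 1)) atTop (𝓝 1) :=
    tendsto_natCast_div_add_atTop 1
  have h1 : Tendsto (fun j : ℕ => ∑ i ∈ Finset.range (d + 1),
      ((j : ℝ) / ((j : ℝ) + 1)) ^ (d - i)) atTop (𝓝 (∑ i ∈ Finset.range (d + 1), 1 ^ (d - i))) :=
    tendsto_finsetSum _ fun i _ => h0.pow _
  simp only [one_pow, Finset.sum_const, Finset.card_range, nsmul_eq_mul, mul_one,
    Nat.cast_add, Nat.cast_one] at h1
  refine h1.congr fun j => ?_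
  have hj : (j : ℝ) + 1 ≠ 0 := by positivity
  rw [← (Commute.all ((j : ℝ) + 1) (j : ℝ)).mul_geom_sum₂, add_sub_cancel_left, one_mul,
    Finset.sum_div]
  refine Finset.sum_congr rfl fun i hi => ?_
  have : ((j : ℝ) + 1) ^ d = ((j : ℝ) + 1) ^ i * ((j : ℝ) + 1) ^ (d - i) := by
    rw [← pow_add, Nat.add_sub_cancel' (by have := Finset.mem_range.1 hi; omega)]
  rw [div_pow, div_eq_div_iff (by positivity) (by positivity)]
  rw [this, show d + 1 - 1 - i = d - i by omega]
  ring

/-- Summation of asymptotics (Stolz–Cesàro): if the differences of `a` grow like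
`e j ^ d / d!` then `a` grows like `e j ^ (d + 1) / (d + 1)!`. -/
theorem tendsto_factorial_mul_div_pow_succ {a b : ℕ → ℝ} {c d : ℕ} {e : ℝ}
    (hab : ∀ j ≥ c, a (j + 1) = a j + b (j + 1))
    (hb : Tendsto (fun j : ℕ => (d.factorial : ℝ) * b j / (j : ℝ) ^ d) atTop (𝓝 e)) :
    Tendsto (fun j : ℕ => ((d + 1).factorial : ℝ) * a j / (j : ℝ) ^ (d + 1)) atTop (𝓝 e) := by
  let K : ℝ := (d + 1).factorial
  have hK : K ≠ 0 := by positivity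
  let g : ℕ → ℝ := fun j => ((j : ℝ) + 1) ^ (d + 1) - (j : ℝ) ^ (d + 1)
  have hg : ∀ j, 0 < g j := fun j => sub_pos.2 (pow_lt_pow_left₀ (by linarith) (by positivity) (by omega))
  have hsumg : ∀ n, ∑ i ∈ Finset.range n, g i = (n : ℝ) ^ (d + 1) := fun n => by
    have := Finset.sum_range_sub (fun i : ℕ => (i : ℝ) ^ (d + 1)) n
    simpa [g] using this
  -- `u` is the error against the expected main term. Its increments are `o(g)`, and the partial
  -- sums of `g` are `n ^ (d + 1)`, so `u` is `o(n ^ (d + 1))`.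
  let u : ℕ → ℝ := fun j => K * a j - e * (j : ℝ) ^ (d + 1)
  have hsmall : (fun j => u (j + 1) - u j) =o[atTop] g := by
    rw [isLittleO_iff_tendsto (fun j h => absurd h (hg j).ne')]
    have h1 : Tendsto (fun j : ℕ => (d.factorial : ℝ) * b (j + 1) / ((j : ℝ) + 1) ^ d) atTop (𝓝 e) := by
      simpa using (tendsto_add_atTop_iff_nat 1).2 hb
    have h2 := ((h1.mul_const ((d : ℝ) + 1)).div (tendsto_succ_pow_sub_pow_div d)
      (by positivity)).sub_const e
    rw [mul_div_cancel_right₀ _ (by positivity), sub_self] at h2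
    refine h2.congr' ?_
    filter_upwards [eventually_ge_atTop c] with j hj
    have hgj := (hg j).ne'
    have : u (j + 1) - u j = K * b (j + 1) - e * g j := by
      simp only [u, g, hab j hj]
      push_cast
      ring
    rw [this, sub_div, mul_div_cancel_right₀ _ hgj]
    congr 1
    simp only [K, Nat.factorial_succ, Pi.div_apply]
    push_cast
    change _ / (g j / _) = _
    field_simp
  have hsum := hsmall.sum_range (fun j => (hg j).le) (by
    simp only [hsumg]
    exact (tendsto_pow_atTop (by omega)).comp tendsto_natCast_atTop_atTop)
  simp only [Finset.sum_range_sub, hsumg] at hsum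
  have hlim := hsum.tendsto_div_nhds_zero
  have hconst : Tendsto (fun n : ℕ => u 0 / (n : ℝ) ^ (d + 1)) atTop (𝓝 0) :=
    tendsto_const_nhds.div_atTop
      ((tendsto_pow_atTop (by omega)).comp tendsto_natCast_atTop_atTop)
  have := (hlim.add hconst).add_const e
  rw [add_zero, zero_add] at this
  refine this.congr' ?_
  filter_upwards [eventually_gt_atTop 0] with n hn
  have hn' : (n : ℝ) ^ (d + 1) ≠ 0 := by positivity
  simp only [u, K]
  field_simp
  ring

end Asymptotic

section Recursion

open scoped Pointwise

variable {R : Type*} [CommRing R] {N : Type*} [AddCommGroup N] [Module R N]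

/-- `(N / xN) / m ^ j (N / xN)` as a quotient of `N`. -/
theorem ker_mkQ_comp_mkQ (x : R) (I : Ideal R) :
    LinearMap.ker ((I • ⊤ : Submodule R (QuotSMulTop x N)).mkQ ∘ₗ
      (Submodule.mkQ _ : N →ₗ[R] QuotSMulTop x N)) = I • ⊤ ⊔ LinearMap.range (LinearMap.lsmul R N x) := by
  have hr : LinearMap.range (LinearMap.lsmul R N x) = (x • ⊤ : Submodule R N) := by
    rw [← Submodule.map_top]
    rfl
  rw [LinearMap.ker_comp, Submodule.ker_mkQ,
    ← LinearMap.range_eq_top.2 (Submodule.mkQ_surjective (x • ⊤ : Submodule R N)),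
    ← Submodule.map_top, ← Submodule.map_smul'', Submodule.comap_map_eq, Submodule.ker_mkQ, hr]

variable [IsLocalRing R]

theorem hilbertFun_one_quotSMulTop {x : R} (hx : x ∈ maximalIdeal R) :
    hilbertFun R (QuotSMulTop x N) 1 = hilbertFun R N 1 := by
  have h := ker_mkQ_comp_mkQ (N := N) x (maximalIdeal R ^ 1)
  rw [sup_eq_left.2] at h
  · exact ((Submodule.quotEquivOfEq _ _ h.symm).trans (LinearMap.quotKerEquivOfSurjective _
      ((Submodule.mkQ_surjective _).comp (Submodule.mkQ_surjective _)))).length_eq.symm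
  · rintro _ ⟨n, rfl⟩
    rw [pow_one]
    exact Submodule.smul_mem_smul hx trivial

/-- Length is additive on `0 → N/m^j N → N/m^(j+1) N → (N/xN)/m^(j+1)(N/xN) → 0`, whose first map is
multiplication by `x`; the hypothesis is exactly its injectivity. -/
theorem hilbertFun_succ {x : R} (hx : x ∈ maximalIdeal R) {j : ℕ}
    (h : ∀ u : N, x • u ∈ (maximalIdeal R ^ (j + 1) • ⊤ : Submodule R N) →
      u ∈ (maximalIdeal R ^ j • ⊤ : Submodule R N)) :
    hilbertFun R N (j + 1) = hilbertFun R N j + hilbertFun R (QuotSMulTop x N) (j + 1) := by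
  let P := (maximalIdeal R ^ j • ⊤ : Submodule R N)
  let Q := (maximalIdeal R ^ (j + 1) • ⊤ : Submodule R N)
  have hPQ : P ≤ Q.comap (LinearMap.lsmul R N x) := by
    rw [Submodule.smul_le]
    intro r hr n _
    change x • r • n ∈ Q
    rw [smul_smul]
    exact Submodule.smul_mem_smul (pow_succ' (maximalIdeal R) j ▸ Ideal.mul_mem_mul hx hr) trivial
  let φ := Submodule.mkQ (maximalIdeal R ^ (j + 1) • ⊤ : Submodule R (QuotSMulTop x N)) ∘ₗ
      (Submodule.mkQ _ : N →ₗ[R] QuotSMulTop x N)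
  have hφ : LinearMap.ker φ = Q ⊔ LinearMap.range (LinearMap.lsmul R N x) := ker_mkQ_comp_mkQ x _
  refine Module.length_eq_add_of_exact (Submodule.mapQ P Q (LinearMap.lsmul R N x) hPQ)
    (Submodule.liftQ Q φ (hφ ▸ le_sup_left)) ?_ ?_ ?_
  · rw [← LinearMap.ker_eq_bot, Submodule.mapQ, Submodule.ker_liftQ_eq_bot]
    intro u hu
    exact h u ((Submodule.Quotient.mk_eq_zero _).1 hu)
  · rw [← LinearMap.range_eq_top, Submodule.range_liftQ, LinearMap.range_eq_top]
    exact (Submodule.mkQ_surjective _).comp (Submodule.mkQ_surjective _)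
  · rw [LinearMap.exact_iff, Submodule.ker_liftQ, hφ, Submodule.range_mapQ, Submodule.map_sup,
      Submodule.mkQ_map_self, bot_sup_eq]

end Recursion

end LocalAlg

namespace LocalAlg

open IsLocalRing

/-! ### General elements and superficial elements via the Rees algebra -/

section Avoidance

/-- Over a local ring with infinite residue field, a finitely generated module is not a finite
union of proper submodules. -/
theorem exists_forall_notMem_of_infinite_residueField {R : Type*} [CommRing R] [IsLocalRing R]
    [Infinite (ResidueField R)] {W : Type*} [AddCommGroup W] [Module R W] [Module.Finite R W]
    {ι : Type*} [Finite ι] (V : ι → Submodule R W) (hV : ∀ i, V i ≠ ⊤) : ∃ x, ∀ i, x ∉ V i := by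
  let _ := Ideal.Quotient.field (maximalIdeal R)
  have : Infinite (R ⧸ maximalIdeal R) := ‹Infinite (ResidueField R)›
  let q := (maximalIdeal R • ⊤ : Submodule R W).mkQ
  let p : ι → Submodule (R ⧸ maximalIdeal R) (W ⧸ (maximalIdeal R • ⊤ : Submodule R W)) := fun i =>
    { (V i).map q with
      smul_mem' := fun c z hz => by
        obtain ⟨r, rfl⟩ := Ideal.Quotient.mk_surjective c
        exact ((V i).map q).smul_mem r hz }
  obtain ⟨z, hz⟩ := Submodule.exists_forall_notMem_of_forall_ne_top p fun i hi => hV i (by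
    rw [← IsLocalRing.map_mkQ_eq_top, eq_top_iff]
    intro z _
    have : z ∈ p i := hi ▸ trivial
    exact this)
  obtain ⟨x, rfl⟩ := Submodule.mkQ_surjective _ z
  exact ⟨x, fun i hx => hz i ⟨x, hx, rfl⟩⟩

/-- A general element of `W` acts on a finite module `G` in such a way that whatever it annihilates
is annihilated by a power of the ideal generated by the image of `W`. -/
theorem exists_notMem_and_pow_smul_eq_zero {R : Type*} [CommRing R] [IsLocalRing R]
    [Infinite (ResidueField R)] {W : Type*} [AddCommGroup W] [Module R W] [Module.Finite R W]
    {ι : Type*} [Finite ι] (V : ι → Submodule R W) (hV : ∀ i, V i ≠ ⊤)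
    {A : Type*} [CommRing A] [IsNoetherianRing A] [Algebra R A] (φ : W →ₗ[R] A)
    (G : Type*) [AddCommGroup G] [Module A G] [Module.Finite A G] :
    ∃ x, (∀ i, x ∉ V i) ∧ ∃ c, ∀ a ∈ Ideal.span (Set.range φ) ^ c, ∀ g : G,
      φ x • g = 0 → a • g = 0 := by
  have := (associatedPrimes.finite A G).to_subtype
  let V' : associatedPrimes A G → Submodule R W := fun p =>
    (p.1.restrictScalars R).comap φ
  -- Associated primes containing all of `φ(W)` cannot be avoided; they are harmless, since they
  -- already contain the ideal generated by `φ(W)`.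
  let ι' := { p : associatedPrimes A G // V' p ≠ ⊤ }
  obtain ⟨x, hx⟩ := exists_forall_notMem_of_infinite_residueField
    (Sum.elim V (fun p : ι' => V' p.1)) (by rintro (i | p); exacts [hV i, p.2])
  refine ⟨x, fun i => hx (Sum.inl i), ?_⟩
  let K : Submodule A G := LinearMap.ker (LinearMap.lsmul A G (φ x))
  -- A minimal prime over the annihilator of `K` is an associated prime of `G` containing `φ x`. By
  -- the choice of `x` it must contain all of `φ(W)`.
  have hK : Ideal.span (Set.range φ) ≤ (Module.annihilator A K).radical := by
    rw [← Ideal.sInf_minimalPrimes, le_sInf_iff]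
    intro p hp
    have hpK := Module.associatedPrimes.minimalPrimes_annihilator_subset_associatedPrimes A K hp
    have hpG : p ∈ associatedPrimes A G :=
      associatedPrimes.subset_of_injective K.injective_subtype hpK
    have hxp : φ x ∈ p := hp.1.2 (Module.mem_annihilator.2 fun k => Subtype.ext k.2)
    have htop : V' ⟨p, hpG⟩ = ⊤ := by
      by_contra hne
      exact hx (Sum.inr ⟨⟨p, hpG⟩, hne⟩) hxp
    rw [Ideal.span_le]
    rintro _ ⟨w, rfl⟩
    have : w ∈ V' ⟨p, hpG⟩ := htop ▸ trivial
    exact this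
  obtain ⟨c, hc⟩ := Ideal.exists_pow_le_of_le_radical_of_fg hK (IsNoetherian.noetherian _)
  exact ⟨c, fun a ha g hg => congrArg Subtype.val (Module.mem_annihilator.1 (hc ha) ⟨g, hg⟩)⟩

end Avoidance

section Superficial

open Polynomial

variable {R : Type*} [CommRing R] (I : Ideal R)

/-- The degree-`l` homogeneous element `r T ^ l` of the Rees algebra. -/
noncomputable def reesMonomial (l : ℕ) : (I ^ l : Ideal R) →ₗ[R] reesAlgebra I where
  toFun r := ⟨monomial l (r : R), reesAlgebra.monomial_mem.2 r.2⟩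
  map_add' r s := Subtype.ext (by simp)
  map_smul' c r := Subtype.ext (by simp [smul_monomial])

/-- The irrelevant ideal of the Rees algebra, generated in degree one. -/
noncomputable def reesIrrelevant : Ideal (reesAlgebra I) :=
  Ideal.span (Set.range (reesMonomial I 1))

theorem reesMonomial_mem_pow (l : ℕ) (r : (I ^ l : Ideal R)) :
    reesMonomial I l r ∈ reesIrrelevant I ^ l := by
  induction l with
  | zero => simp
  | succ l ih =>
    obtain ⟨r, hr⟩ := r
    have hr' : r ∈ I * I ^ l := by rwa [← pow_succ']
    induction hr' using Submodule.mul_induction_on' with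
    | mem_mul_mem a ha b hb =>
      have : reesMonomial I (l + 1) ⟨a * b, hr⟩ =
          reesMonomial I 1 ⟨a, by rwa [pow_one]⟩ * reesMonomial I l ⟨b, hb⟩ :=
        Subtype.ext (by simp [reesMonomial, monomial_mul_monomial, add_comm])
      rw [this, pow_succ']
      exact Ideal.mul_mem_mul (Ideal.subset_span ⟨_, rfl⟩) (ih _)
    | add a ha b hb h1 h2 =>
      have : reesMonomial I (l + 1) ⟨a + b, hr⟩ =
          reesMonomial I (l + 1) ⟨a, pow_succ' I l ▸ ha⟩ +
          reesMonomial I (l + 1) ⟨b, pow_succ' I l ▸ hb⟩ := by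
        rw [← map_add]; rfl
      rw [this]
      exact Ideal.add_mem _ (h1 _) (h2 _)

theorem eq_sum_reesMonomial (a : reesAlgebra I) :
    a = ∑ l ∈ (a : R[X]).support, reesMonomial I l ⟨(a : R[X]).coeff l, a.2 l⟩ := by
  apply Subtype.ext
  rw [AddSubmonoidClass.coe_finsetSum]
  exact (a : R[X]).as_sum_support

variable (N : Type*) [AddCommGroup N] [Module R N]

/-- The filtration `j ↦ I ^ (j + 1) N`. -/
def shiftedFiltration : I.Filtration N where
  N j := I ^ (j + 1) • ⊤
  mono j := Submodule.smul_mono_left (Ideal.pow_le_pow_right (by omega))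
  smul_le j := by rw [← Submodule.mul_smul, ← pow_succ']

/-- The Rees module `⨁ I ^ j N`. -/
def ReesModule : Type _ := (I.stableFiltration (⊤ : Submodule R N)).submodule

noncomputable instance : AddCommGroup (ReesModule I N) :=
  inferInstanceAs (AddCommGroup (I.stableFiltration (⊤ : Submodule R N)).submodule)

noncomputable instance : Module (reesAlgebra I) (ReesModule I N) :=
  inferInstanceAs (Module (reesAlgebra I) (I.stableFiltration (⊤ : Submodule R N)).submodule)

instance [IsNoetherianRing R] [Module.Finite R N] :
    Module.Finite (reesAlgebra I) (ReesModule I N) :=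
  Module.Finite.iff_fg.2 (((I.stableFiltration (⊤ : Submodule R N)).submodule_fg_iff_stable
    fun _ => IsNoetherian.noetherian _).2 (I.stableFiltration_stable ⊤))

/-- The inclusion of the Rees module in `N[T]`. -/
noncomputable def ReesModule.val : ReesModule I N →ₗ[reesAlgebra I] PolynomialModule R N :=
  (I.stableFiltration (⊤ : Submodule R N)).submodule.subtype

/-- The associated graded module `⨁ I ^ j N / I ^ (j + 1) N` over the Rees algebra. -/
abbrev AssocGraded : Type _ :=
  ReesModule I N ⧸ (shiftedFiltration I N).submodule.comap (ReesModule.val I N)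

variable {I N}

/-- The homogeneous element `u T ^ j` of the Rees module. -/
noncomputable def ReesModule.single (j : ℕ) (u : N) (hu : u ∈ (I ^ j • ⊤ : Submodule R N)) :
    ReesModule I N :=
  ⟨PolynomialModule.single R j u, fun i => by
    rw [PolynomialModule.coeff_single]
    by_cases h : j = i
    · subst h; simpa using hu
    · rw [Finsupp.single_eq_of_ne' h]; exact Submodule.zero_mem _⟩

theorem ReesModule.val_single (j : ℕ) (u : N) (hu : u ∈ (I ^ j • ⊤ : Submodule R N)) :
    val I N (single j u hu) = PolynomialModule.single R j u := rfl

theorem AssocGraded.mk_eq_zero_iff (f : ReesModule I N) :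
    (Submodule.Quotient.mk f : AssocGraded I N) = 0 ↔
      ∀ i, (ReesModule.val I N f).coeff i ∈ (I ^ (i + 1) • ⊤ : Submodule R N) := by
  rw [Submodule.Quotient.mk_eq_zero]
  exact Iff.rfl

theorem coeff_val_reesMonomial_smul (l : ℕ) (r : (I ^ l : Ideal R)) (f : ReesModule I N) (i : ℕ)
    (hi : l ≤ i) : (ReesModule.val I N (reesMonomial I l r • f)).coeff i =
      (r : R) • (ReesModule.val I N f).coeff (i - l) := by
  rw [map_smul]
  change (monomial l (r : R) • ReesModule.val I N f).coeff i = _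
  rw [PolynomialModule.monomial_smul_apply, if_pos hi]

/-- A submodule of the associated graded module killed by a power of the irrelevant ideal lives in
bounded degrees. -/
theorem AssocGraded.exists_bound_of_pow_smul_eq_zero [IsNoetherianRing R] [Module.Finite R N]
    (K : Submodule (reesAlgebra I) (AssocGraded I N)) {c : ℕ}
    (hK : ∀ a ∈ reesIrrelevant I ^ c, ∀ k ∈ K, a • k = 0) :
    ∃ B, ∀ k ∈ K, ∃ f : ReesModule I N, Submodule.Quotient.mk f = k ∧
      ∀ i ≥ B, (ReesModule.val I N f).coeff i = 0 := by
  obtain ⟨s, hs⟩ := IsNoetherian.noetherian K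
  choose lift hlift using Submodule.mkQ_surjective
    ((shiftedFiltration I N).submodule.comap (ReesModule.val I N))
  obtain ⟨D, hD⟩ : ∃ D, ∀ g ∈ s, ∀ i ≥ D, (ReesModule.val I N (lift g)).coeff i = 0 := by
    classical
    refine ⟨(s.biUnion fun g => (ReesModule.val I N (lift g)).coeff.support).sup id + 1,
      fun g hg i hi => ?_⟩
    by_contra hne
    have : i ≤ (s.biUnion fun g => (ReesModule.val I N (lift g)).coeff.support).sup id :=
      Finset.le_sup (f := id) (Finset.mem_biUnion.2 ⟨g, hg, Finsupp.mem_support_iff.2 hne⟩)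
    omega
  refine ⟨D + c, fun k hk => ?_⟩
  let Q : AddSubmonoid (AssocGraded I N) :=
    { carrier := { k | ∃ f : ReesModule I N, Submodule.Quotient.mk f = k ∧
        ∀ i ≥ D + c, (ReesModule.val I N f).coeff i = 0 }
      zero_mem' := ⟨0, rfl, fun i _ => by simp⟩
      add_mem' := by
        rintro _ _ ⟨f, rfl, hf⟩ ⟨g, rfl, hg⟩
        exact ⟨f + g, rfl, fun i hi => by simp [hf i hi, hg i hi]⟩ }
  -- Homogeneous multipliers of degree at least `c` kill the generators of `K`; those of smaller
  -- degree raise degrees, which start below `D`, to below `D + c`.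
  have key : ∀ k ∈ Submodule.span (reesAlgebra I) (s : Set (AssocGraded I N)),
      ∀ a : reesAlgebra I, a • k ∈ Q := by
    intro k hk
    induction hk using Submodule.span_induction with
    | zero => intro a; rw [smul_zero]; exact Q.zero_mem
    | add x y _ _ hx hy => intro a; rw [smul_add]; exact Q.add_mem (hx a) (hy a)
    | smul b x _ hx => intro a; rw [smul_smul]; exact hx _
    | mem g hg =>
      intro a
      rw [eq_sum_reesMonomial I a, Finset.sum_smul]
      refine Q.sum_mem fun l _ => ?_
      generalize (⟨_, _⟩ : (I ^ l : Ideal R)) = r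
      by_cases hl : c ≤ l
      · rw [hK _ (Ideal.pow_le_pow_right hl (reesMonomial_mem_pow I l r)) g
          (hs ▸ Submodule.subset_span hg)]
        exact Q.zero_mem
      · refine ⟨reesMonomial I l r • lift g, ?_, fun i hi => ?_⟩
        · rw [Submodule.Quotient.mk_smul]
          exact congrArg _ (hlift g)
        · rw [coeff_val_reesMonomial_smul l r _ i (by omega), hD g hg _ (by omega), smul_zero]
  have := key k (hs ▸ hk) 1
  rwa [one_smul] at this

end Superficial

end LocalAlg

namespace LocalAlg

open IsLocalRing

/-! ### Existence of a regular superficial element -/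

section SuperficialElement

variable {R : Type*} [CommRing R] [IsLocalRing R] [IsNoetherianRing R]
  {N : Type*} [AddCommGroup N] [Module R N] [Module.Finite R N]

/-- Over a Noetherian local ring with infinite residue field, a finitely generated module of
positive depth has a regular superficial element. -/
theorem exists_superficial [Infinite (ResidueField R)]
    (h : ∃ a ∈ maximalIdeal R, IsSMulRegular N a) :
    ∃ x ∈ maximalIdeal R, IsSMulRegular N x ∧ ∃ c, ∀ j ≥ c, ∀ u : N,
      x • u ∈ (maximalIdeal R ^ (j + 1) • ⊤ : Submodule R N) →
      u ∈ (maximalIdeal R ^ j • ⊤ : Submodule R N) := by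
  let m := maximalIdeal R
  obtain ⟨a, ha, hreg⟩ := h
  have hunion : ∀ y : R, IsSMulRegular N y ↔ ∀ p ∈ associatedPrimes R N, y ∉ p := by
    intro y
    have := Set.ext_iff.1 (biUnion_associatedPrimes_eq_compl_regular R N) y
    simp only [Set.mem_iUnion, SetLike.mem_coe, exists_prop, Set.mem_compl_iff,
      Set.mem_ofPred_eq] at this
    rw [← not_iff_not, ← this]
    push Not
    rfl
  have := (associatedPrimes.finite R N).to_subtype
  -- One choice does both jobs: avoiding the associated primes of `N` makes `x` regular, and
  -- generality on the associated graded module makes the kernel of its initial form live in bounded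
  -- degrees. The source is `m ^ 1` to match `reesMonomial m 1`.
  obtain ⟨⟨x, hxm⟩, hxV, c₀, hc₀⟩ := exists_notMem_and_pow_smul_eq_zero
    (W := (m ^ 1 : Ideal R)) (fun p : associatedPrimes R N => Submodule.comap (m ^ 1).subtype p.1)
    (fun p hp => (hunion a).1 hreg p.1 p.2 (by
      have : (⟨a, by rwa [pow_one]⟩ : (m ^ 1 : Ideal R)) ∈ Submodule.comap (m ^ 1).subtype p.1 :=
        hp ▸ trivial
      exact this))
    (reesMonomial m 1) (AssocGraded m N)
  have hx : x ∈ m := by rwa [pow_one] at hxm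
  have hxreg : IsSMulRegular N x := (hunion x).2 fun p hp => hxV ⟨p, hp⟩
  refine ⟨x, hx, hxreg, ?_⟩
  let K : Submodule (reesAlgebra m) (AssocGraded m N) :=
    LinearMap.ker (LinearMap.lsmul (reesAlgebra m) (AssocGraded m N) (reesMonomial m 1 ⟨x, hxm⟩))
  obtain ⟨B, hB⟩ := AssocGraded.exists_bound_of_pow_smul_eq_zero K (c := c₀)
    fun a ha k hk => hc₀ a ha k hk
  have hstep : ∀ i ≥ B, ∀ u ∈ (m ^ i • ⊤ : Submodule R N),
      x • u ∈ (m ^ (i + 2) • ⊤ : Submodule R N) → u ∈ (m ^ (i + 1) • ⊤ : Submodule R N) := by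
    intro i hi u hu hxu
    have hmem : (Submodule.Quotient.mk (ReesModule.single i u hu) : AssocGraded m N) ∈ K := by
      change reesMonomial m 1 ⟨x, hxm⟩ • (Submodule.Quotient.mk _ : AssocGraded m N) = 0
      rw [← Submodule.Quotient.mk_smul, AssocGraded.mk_eq_zero_iff]
      intro l
      rcases Nat.eq_zero_or_pos l with rfl | hl
      · rw [map_smul]
        change (Polynomial.monomial 1 x • ReesModule.val m N _).coeff 0 ∈ _
        rw [PolynomialModule.monomial_smul_apply, if_neg (by omega)]
        exact Submodule.zero_mem _
      · rw [coeff_val_reesMonomial_smul _ _ _ _ hl, ReesModule.val_single,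
          PolynomialModule.coeff_single]
        by_cases hl' : i = l - 1
        · subst hl'
          rw [Finsupp.single_eq_same, show l + 1 = l - 1 + 2 by omega]
          exact hxu
        · rw [Finsupp.single_eq_of_ne' hl', smul_zero]
          exact Submodule.zero_mem _
    obtain ⟨f, hf, hf0⟩ := hB _ hmem
    have h1 := (AssocGraded.mk_eq_zero_iff (ReesModule.single i u hu - f)).1
      ((Submodule.Quotient.mk_sub _).trans (sub_eq_zero.2 hf.symm)) i
    rw [map_sub, ReesModule.val_single] at h1
    change (PolynomialModule.single R i u).coeff i - (ReesModule.val m N f).coeff i ∈ _ at h1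
    rwa [hf0 i hi, sub_zero, PolynomialModule.coeff_single, Finsupp.single_eq_same] at h1
  -- Artin–Rees and regularity of `x` place `u` in `m ^ B N`; from there `hstep` climbs one degree
  -- at a time up to `j`.
  obtain ⟨k, hk⟩ := Ideal.exists_pow_inf_eq_pow_smul m (LinearMap.range (LinearMap.lsmul R N x))
  refine ⟨k + B, fun j hj u hu => ?_⟩
  have hmono : ∀ {s t : ℕ}, s ≤ t → (m ^ t • ⊤ : Submodule R N) ≤ m ^ s • ⊤ := fun hst =>
    Submodule.smul_mono_left (Ideal.pow_le_pow_right hst)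
  have huB : u ∈ (m ^ B • ⊤ : Submodule R N) := by
    have h1 : x • u ∈ m ^ (j + 1 - k) • (m ^ k • ⊤ ⊓ LinearMap.range (LinearMap.lsmul R N x)) := by
      rw [← hk (j + 1) (by omega)]
      exact ⟨hu, u, rfl⟩
    have h2 : x • u ∈ (m ^ B • ⊤ : Submodule R N).map (LinearMap.lsmul R N x) := by
      rw [Submodule.map_smul'', Submodule.map_top]
      exact Submodule.smul_mono (Ideal.pow_le_pow_right (by omega)) inf_le_right h1
    obtain ⟨v, hv, hvu⟩ := h2
    exact hxreg hvu ▸ hv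
  have hind : ∀ i, B ≤ i → i ≤ j → u ∈ (m ^ i • ⊤ : Submodule R N) := by
    intro i hBi
    induction i, hBi using Nat.le_induction with
    | base => exact fun _ => huB
    | succ i hi ih =>
      exact fun hij => hstep i hi u (ih (by omega)) (hmono (by omega) hu)
  exact hind j (by omega) le_rfl

end SuperficialElement

end LocalAlg

namespace LocalAlg

open IsLocalRing CategoryTheory TensorProduct Filter Topology

/-! ### Regular sequences under division and flat base change -/

section RegularSequences

open RingTheory.Sequence Abelian

theorem maximalIdeal_smul_top_lt_top {R : Type*} [CommRing R] [IsLocalRing R] (N : Type*)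
    [AddCommGroup N] [Module R N] [Module.Finite R N] [Nontrivial N] :
    (maximalIdeal R • ⊤ : Submodule R N) < ⊤ :=
  lt_top_iff_ne_top.2 (Submodule.top_ne_ideal_smul_of_le_jacobson_annihilator
    (maximalIdeal_le_jacobson _)).symm

/-- Dividing by any regular element of the maximal ideal lowers the depth by one only. -/
theorem exists_isRegular_quotSMulTop {R : Type u} [CommRing R] [IsLocalRing R]
    [IsNoetherianRing R] {N : Type u} [AddCommGroup N] [Module R N] [Module.Finite R N]
    [Nontrivial N] {n : ℕ} (h : ∃ rs : List R, rs.length = n + 1 ∧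
      (∀ r ∈ rs, r ∈ maximalIdeal R) ∧ IsRegular N rs)
    {x : R} (hx : x ∈ maximalIdeal R) (hreg : IsSMulRegular N x) :
    ∃ rs : List R, rs.length = n ∧ (∀ r ∈ rs, r ∈ maximalIdeal R) ∧
      IsRegular (QuotSMulTop x N) rs := by
  have : Nontrivial (QuotSMulTop x N) := nontrivial_quotSMulTop_of_mem_maximalIdeal N hx
  let k := ModuleCat.of R (Shrink.{u} (R ⧸ maximalIdeal R))
  -- Rees' criterion reads depth from the vanishing of `Ext(k, -)`, so any regular `x` may replace
  -- the first term of the sequence: `Ext^i(k, N/xN)` sits between `Ext^i(k, N)` and `Ext^(i+1)(k,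
  -- N)`.
  have h1 : ∀ i < n + 1, Subsingleton (Ext k (ModuleCat.of R N) i) :=
    ((ModuleCat.exists_isRegular_tfae (maximalIdeal R) (n + 1) (ModuleCat.of R N)
      (maximalIdeal_smul_top_lt_top N)).out 3 1).1 h
  refine ((ModuleCat.exists_isRegular_tfae (maximalIdeal R) n (ModuleCat.of R (QuotSMulTop x N))
      (maximalIdeal_smul_top_lt_top (QuotSMulTop x N))).out 1 3).1 fun i hi => ?_
  have zero1 := AddCommGrpCat.isZero_of_iff_subsingleton.mpr (h1 i (by omega))
  have zero2 := AddCommGrpCat.isZero_of_iff_subsingleton.mpr (h1 (i + 1) (by omega))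
  exact AddCommGrpCat.subsingleton_of_isZero <| ShortComplex.Exact.isZero_of_both_zeros
    ((Ext.covariant_sequence_exact₃' k
      (IsSMulRegular.smulShortComplex_shortExact (M := ModuleCat.of R N) hreg)) i (i + 1) rfl)
    (zero1.eq_zero_of_src _) (zero2.eq_zero_of_tgt _)

/-- A finite supremum of lengths is attained. -/
theorem exists_isRegular_of_isCohenMacaulay {R : Type u} [CommRing R] [IsLocalRing R]
    {N : Type u} [AddCommGroup N] [Module R N] [Nontrivial N] (hN : IsCohenMacaulay R N)
    {n : ℕ} (hn : Module.supportDim R N = n) :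
    ∃ rs : List R, rs.length = n ∧ (∀ r ∈ rs, r ∈ maximalIdeal R) ∧ IsRegular N rs := by
  have hd : depth R N = n := by
    have := hN.resolve_left (not_subsingleton N)
    rw [hn] at this
    exact_mod_cast this
  by_contra! hne
  have hlt : ∀ rs : List R, (∀ r ∈ rs, r ∈ maximalIdeal R) → IsRegular N rs → rs.length < n := by
    intro rs hrs hreg
    refine lt_of_le_of_ne ?_ fun h => hne rs h hrs hreg
    have : (rs.length : ℕ∞) ≤ depth R N :=
      le_iSup_of_le rs (le_iSup_of_le hrs (le_iSup_of_le hreg le_rfl))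
    rw [hd] at this
    exact_mod_cast this
  have hpos := hlt [] (by simp) (IsRegular.nil R N)
  have : depth R N ≤ ((n - 1 : ℕ) : ℕ∞) := iSup_le fun rs => iSup_le fun hrs => iSup_le fun hreg =>
    Nat.cast_le.2 (Nat.le_sub_one_of_lt (hlt rs hrs hreg))
  rw [hd] at this
  have : n ≤ n - 1 := by exact_mod_cast this
  simp at hpos
  omega

/-- The Cohen–Macaulay condition (in terms of regular sequences) ascends along flat local
extensions with trivial closed fibre. -/
theorem supportDim_baseChange_of_isRegular {R : Type u} [CommRing R] [IsLocalRing R]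
    [IsNoetherianRing R] {N : Type u} [AddCommGroup N] [Module R N] [Module.Finite R N]
    [Nontrivial N] (S : Type u) [CommRing S] [IsLocalRing S] [IsNoetherianRing S] [Algebra R S]
    [Module.Flat R S] (hS : (maximalIdeal R).map (algebraMap R S) = maximalIdeal S)
    {rs : List R} (hreg : IsRegular N rs) (hdim : Module.supportDim R N = rs.length) :
    IsRegular (S ⊗[R] N) (rs.map (algebraMap R S)) ∧
      Module.supportDim S (S ⊗[R] N) = rs.length := by
  have : IsLocalHom (algebraMap R S) := ((local_hom_TFAE (algebraMap R S)).out 0 2).2 hS.le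
  have : Module.FaithfullyFlat R S := Module.FaithfullyFlat.of_flat_of_isLocalHom
  have hregS := hreg.of_faithfullyFlat_of_isBaseChange (TensorProduct.isBaseChange R N S)
  refine ⟨hregS, ?_⟩
  have h0 : Module.supportDim R (N ⧸ (Ideal.ofList rs • ⊤ : Submodule R N)) = 0 := by
    have h1 := Module.supportDim_add_length_eq_supportDim_of_isRegular rs hreg
    have : Nontrivial (N ⧸ (Ideal.ofList rs • ⊤ : Submodule R N)) := hreg.quot_ofList_smul_nontrivial ⊤
    have h2 := Module.supportDim_ne_bot_of_nontrivial R (N ⧸ (Ideal.ofList rs • ⊤ : Submodule R N))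
    rw [hdim] at h1
    generalize Module.supportDim R (N ⧸ (Ideal.ofList rs • ⊤ : Submodule R N)) = d at h1 h2
    induction d with
    | bot => exact absurd rfl h2
    | coe d =>
      induction d with
      | top => exact absurd h1 (by exact_mod_cast ENat.top_ne_natCast _)
      | coe d =>
        have : d + rs.length = rs.length := by exact_mod_cast h1
        have : d = 0 := by omega
        subst this
        rfl
  -- Dimension zero means being killed by a power of `m`, a condition that base change to `S`
  -- preserves because `mS` is the maximal ideal of `S`.
  obtain ⟨c, hc⟩ := exists_pow_smul_top_eq_bot_of_supportDim_eq_zero h0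
  have hcS : (maximalIdeal S ^ c • ⊤ :
      Submodule S (S ⊗[R] (N ⧸ (Ideal.ofList rs • ⊤ : Submodule R N)))) = ⊥ := by
    rw [← hS, ← Ideal.map_pow, ← ker_baseChange_mkQ, LinearMap.ker_eq_bot]
    refine Module.Flat.lTensor_preserves_injective_linearMap (M := S) _ ?_
    rw [← LinearMap.ker_eq_bot, Submodule.ker_mkQ, hc]
  have : Nontrivial ((S ⊗[R] N) ⧸ (Ideal.ofList (rs.map (algebraMap R S)) • ⊤ :
      Submodule S (S ⊗[R] N))) := hregS.quot_ofList_smul_nontrivial ⊤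
  have hdimS := Module.supportDim_add_length_eq_supportDim_of_isRegular _ hregS
  rw [← Ideal.map_ofList] at this hdimS
  let e := quotSMulTopBaseChangeEquiv S N (Ideal.ofList rs)
  have : Nontrivial (S ⊗[R] (N ⧸ (Ideal.ofList rs • ⊤ : Submodule R N))) :=
    e.symm.toEquiv.nontrivial
  rw [Module.supportDim_eq_of_equiv e, supportDim_eq_zero_of_pow_smul_top_eq_bot hcS, zero_add,
    List.length_map] at hdimS
  exact hdimS.symm

end RegularSequences

/-! ### Reduction to finite length and the conclusion -/

section Reduction

open RingTheory.Sequence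

open scoped Pointwise

/-- Over a Noetherian local ring with infinite residue field, a Cohen–Macaulay module `N` can be
divided by a superficial regular sequence: the quotient `L` has finite length, equal to the
multiplicity of `N`. -/
theorem exists_finite_length_reduction (R : Type u) [CommRing R] [IsNoetherianRing R]
    (S : Type u) [CommRing S] [IsLocalRing S] [IsNoetherianRing S] [Algebra R S]
    [Infinite (ResidueField S)] (n : ℕ) :
    ∀ (N : Type u) [AddCommGroup N] [Module R N] [Module S N] [IsScalarTower R S N]
      [Module.Finite S N] [Nontrivial N], Module.supportDim S N = n →
      (∃ rs : List S, rs.length = n ∧ (∀ r ∈ rs, r ∈ maximalIdeal S) ∧ IsRegular N rs) →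
    ∃ (L : Type u) (_ : AddCommGroup L) (_ : Module R L) (_ : Module S L),
      IsScalarTower R S L ∧ Module.Finite S L ∧ IsFiniteLength S L ∧
      hilbertFun S L 1 = hilbertFun S N 1 ∧
      Tendsto (fun j : ℕ => (n.factorial : ℝ) * ((hilbertFun S N j).toNat : ℝ) / (j : ℝ) ^ n)
        atTop (𝓝 ((Module.length S L).toNat : ℝ)) ∧
      ∀ (k : ℕ) (X : Type u) [AddCommGroup X] [Module R X] [Module.Finite R X],
        SyzygyMapsExtendUpTo R N (k + n) X → SyzygyMapsExtendUpTo R L k X := by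
  induction n with
  | zero =>
    intro N _ _ _ _ _ _ hdim _
    obtain ⟨c, hc⟩ := exists_pow_smul_top_eq_bot_of_supportDim_eq_zero (by simpa using hdim)
    refine ⟨N, _, _, _, ‹_›, ‹_›, isFiniteLength_of_pow_smul_top_eq_bot hc, rfl, ?_,
      fun k X _ _ _ h => h⟩
    -- In dimension zero the sequence is eventually the constant `ℓ(N)`.
    refine tendsto_const_nhds.congr' ?_
    filter_upwards [eventually_ge_atTop c] with j hj
    have hbot : (maximalIdeal S ^ j • ⊤ : Submodule S N) = ⊥ :=
      le_bot_iff.1 (hc ▸ Submodule.smul_mono_left (Ideal.pow_le_pow_right hj))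
    rw [hilbertFun, (Submodule.quotEquivOfEqBot _ hbot).length_eq]
    simp
  | succ n ih =>
    intro N _ _ _ _ _ _ hdim hdepth
    have hpos : ∃ a ∈ maximalIdeal S, IsSMulRegular N a := by
      obtain ⟨rs, hlen, hmem, hreg⟩ := hdepth
      match rs, hlen with
      | a :: rs, _ =>
        exact ⟨a, hmem a List.mem_cons_self, ((isRegular_cons_iff N a rs).1 hreg).1⟩
    obtain ⟨x, hx, hxreg, c, hc⟩ := exists_superficial hpos
    have : Nontrivial (QuotSMulTop x N) := nontrivial_quotSMulTop_of_mem_maximalIdeal N hx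
    have hdim' : Module.supportDim S (QuotSMulTop x N) = n := by
      have h1 := Module.supportDim_quotSMulTop_succ_eq_supportDim hxreg hx
      rw [hdim] at h1
      have h2 := Module.supportDim_ne_bot_of_nontrivial S (QuotSMulTop x N)
      generalize Module.supportDim S (QuotSMulTop x N) = d at h1 h2
      induction d with
      | bot => exact absurd rfl h2
      | coe d =>
        induction d with
        | top => exact absurd h1 (by exact_mod_cast ENat.top_ne_natCast _)
        | coe d =>
          have : d + 1 = n + 1 := by exact_mod_cast h1
          have : d = n := by omega
          subst this
          rfl
    obtain ⟨L, _, _, _, hT, hF, hL, h1, hlim, hext⟩ := ih (QuotSMulTop x N) hdim'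
      (exists_isRegular_quotSMulTop hdepth hx hxreg)
    refine ⟨L, _, _, _, hT, hF, hL, h1.trans (hilbertFun_one_quotSMulTop hx), ?_, ?_⟩
    · refine tendsto_factorial_mul_div_pow_succ (c := c) (fun j hj => ?_) hlim
      rw [hilbertFun_succ hx (hc j hj), ENat.toNat_add, Nat.cast_add]
      · exact Module.length_ne_top_iff.2 (isFiniteLength_quotient_pow_smul_top j)
      · exact Module.length_ne_top_iff.2 (isFiniteLength_quotient_pow_smul_top (j + 1))
    · intro k X _ _ _ h
      let i : N →ₗ[R] N := (LinearMap.lsmul S N x).restrictScalars R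
      let q : N →ₗ[R] QuotSMulTop x N :=
        (Submodule.mkQ (x • ⊤ : Submodule S N)).restrictScalars R
      have hiq : Function.Exact i q := LinearMap.exact_lsmul_mkQ_smul_top N x
      have hq : Function.Surjective q := Submodule.mkQ_surjective (x • ⊤ : Submodule S N)
      exact hext k X (SyzygyMapsExtendUpTo.of_surjective i q hxreg hiq hq (k + n) X h)

end Reduction

end LocalAlg

namespace LocalAlg

open IsLocalRing CategoryTheory TensorProduct Filter Topology

/-- The Hilbert–Samuel limit of a Cohen–Macaulay module exists, it has the form `μ(N) + l`, and
`β_t μ(N) ≤ β_{t+1} l` when the relevant `Ext` modules vanish. -/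
theorem exists_tendsto_hilbertSamuelSeq_and_betti_mul_le (R : Type u) [CommRing R]
    [IsNoetherianRing R] [IsLocalRing R]
    (M : Type u) [AddCommGroup M] [Module R M] [Module.Finite R M]
    (N : Type u) [AddCommGroup N] [Module R N] [Module.Finite R N] [Nontrivial N]
    (hN : IsCohenMacaulay R N) (n : ℕ) (hn : Module.supportDim R N = n) (t : ℕ)
    (hExt : ∀ i : ℕ, t + 1 ≤ i → i ≤ t + 1 + n →
      Subsingleton (Abelian.Ext (ModuleCat.of R M) (ModuleCat.of R N) i)) :
    ∃ l : ℕ, Tendsto (hilbertSamuelSeq R N (maximalIdeal R)) atTop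
        (𝓝 ((numGen R N : ℝ) + l)) ∧
      betti R (t + 1) M * numGen R N ≤ betti R (t + 2) M * l := by
  obtain ⟨Y, _, _, _, hb1, hb2, hY⟩ := exists_syzygyMapsExtendUpTo n t M hExt
  obtain ⟨rs, hlen, hmem, hreg⟩ := exists_isRegular_of_isCohenMacaulay hN hn
  let S := NagataRing R
  have hS : (maximalIdeal R).map (algebraMap R S) = maximalIdeal S := map_maximalIdeal_nagataRing R
  obtain ⟨hregS, hdimS⟩ := supportDim_baseChange_of_isRegular S hS hreg (hlen ▸ hn)
  have : Nontrivial (S ⊗[R] N) := hregS.nontrivial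
  obtain ⟨L, _, _, _, _, _, hL, h1, hlim, hext⟩ := exists_finite_length_reduction R S n (S ⊗[R] N)
    (hlen ▸ hdimS) ⟨_, by simpa using hlen, fun r hr => by
      obtain ⟨a, ha, rfl⟩ := List.mem_map.1 hr
      exact hS ▸ Ideal.mem_map_of_mem _ (hmem a ha), hregS⟩
  -- Of the `n + 1` degrees of vanishing, `n` are spent on the reduction.
  have hYL : SyzygyMapsExtend R Y L :=
    (hext 1 Y (SyzygyMapsExtendUpTo.baseChange S (1 + n) Y (add_comm n 1 ▸ hY))).1
  have hcount := betti_mul_length_le (maximalIdeal S) hS.le hYL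
  let Q := (maximalIdeal S • ⊤ : Submodule S L)
  have hQ : Module.length S Q ≠ ⊤ :=
    Module.length_ne_top_iff.2 (hL.of_injective Q.injective_subtype)
  have hμ : Module.length S (L ⧸ Q) = numGen R N := by
    rw [numGen, ← hilbertFun_one R N, ← hilbertFun_baseChange R N S hS, ← h1, hilbertFun, pow_one]
  have hsplit : Module.length S L = Module.length S Q + numGen R N := by
    rw [← hμ]
    exact Module.length_eq_add_of_exact Q.subtype Q.mkQ Q.injective_subtype Q.mkQ_surjective
      (LinearMap.exact_subtype_mkQ Q)
  obtain ⟨l, hl⟩ := ENat.ne_top_iff_exists.1 hQ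
  rw [← hl] at hsplit
  refine ⟨l, ?_, ?_⟩
  · rw [hsplit] at hlim
    have hnat : natDim R N = n := by
      rw [natDim, hn]
      rfl
    have : ((l : ℕ∞) + (numGen R N : ℕ∞)).toNat = numGen R N + l := by
      rw [← Nat.cast_add, ENat.toNat_natCast, add_comm]
    rw [this, Nat.cast_add] at hlim
    refine hlim.congr fun j => ?_
    rw [hilbertSamuelSeq, hnat, hilbertFun_baseChange R N S hS]
    rfl
  · change _ ≤ _ * Module.length S Q at hcount
    rw [hsplit, ← hl, ← hb1, ← hb2] at hcount
    have : betti R (t + 1) M * (l + numGen R N) ≤ (betti R (t + 1) M + betti R (t + 2) M) * l := by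
      exact_mod_cast hcount
    linarith

end LocalAlg

theorem mainTheorem9 (R : Type u) [CommRing R] [IsNoetherianRing R] [IsLocalRing R]
    (M : Type u) [AddCommGroup M] [Module R M] [Module.Finite R M]
    (N : Type u) [AddCommGroup N] [Module R N] [Module.Finite R N] [Nontrivial N]
    (hN : LocalAlg.IsCohenMacaulay R N)
    (n : ℕ) (hn : Module.supportDim R N = n)
    (t : ℕ) (ht : 1 ≤ t)
    (hExt : ∀ i : ℕ, t ≤ i → i ≤ t + n →
      Subsingleton (CategoryTheory.Abelian.Ext (ModuleCat.of R M) (ModuleCat.of R N) i)) :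
    -- the limit defining the multiplicity `e(N)` with respect to the maximal ideal exists
    Filter.Tendsto (LocalAlg.hilbertSamuelSeq R N (IsLocalRing.maximalIdeal R)) Filter.atTop
        (nhds (LocalAlg.multiplicity R N (IsLocalRing.maximalIdeal R))) ∧
    -- the growth bound when the denominator `e(N) - μ(N)` is nonzero
    (LocalAlg.multiplicity R N (IsLocalRing.maximalIdeal R) ≠ (LocalAlg.numGen R N : ℝ) →
      (LocalAlg.betti R (t + 1) M : ℝ) ≥
        (LocalAlg.numGen R N : ℝ) /
          (LocalAlg.multiplicity R N (IsLocalRing.maximalIdeal R) - (LocalAlg.numGen R N : ℝ)) *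
          (LocalAlg.betti R t M : ℝ)) ∧
    -- the growth bound with factor `∞` when the denominator vanishes
    (LocalAlg.multiplicity R N (IsLocalRing.maximalIdeal R) = (LocalAlg.numGen R N : ℝ) →
      LocalAlg.betti R t M = 0) := by
  -- The length count needs a free module preceding the `t`-th one, hence `t ≥ 1`.
  obtain ⟨t, rfl⟩ : ∃ s, t = s + 1 := ⟨t - 1, by omega⟩
  obtain ⟨l, hlim, hle⟩ :=
    LocalAlg.exists_tendsto_hilbertSamuelSeq_and_betti_mul_le R M N hN n hn t hExt
  -- `limUnder` is meaningful only because the limit has been shown to exist; here `l = ℓ(mL)`.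
  have he : LocalAlg.multiplicity R N (IsLocalRing.maximalIdeal R) = LocalAlg.numGen R N + l :=
    hlim.limUnder_eq
  rw [he]
  refine ⟨hlim, fun hne => ?_, fun heq => ?_⟩
  · have hl : (0 : ℝ) < l := by
      rcases Nat.eq_zero_or_pos l with rfl | h
      · simp at hne
      · exact_mod_cast h
    rw [add_sub_cancel_left, ge_iff_le, div_mul_eq_mul_div, div_le_iff₀ hl, mul_comm]
    exact_mod_cast hle
  · have hl : l = 0 := by simpa using heq
    have hpos : LocalAlg.numGen R N ≠ 0 := fun h =>
      top_ne_bot ((Submodule.spanFinrank_eq_zero_iff_eq_bot Module.Finite.fg_top).1 h)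
    rw [hl, mul_zero] at hle
    exact (Nat.mul_eq_zero.1 (Nat.le_zero.1 hle)).resolve_right hpos
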